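/- A convex body in $\mathbb{R}^2$ is a compact, convex subset of $\mathbb{R}^2$ with nonempty interior. For a convex body $K\subset[0,1]^2$ and $i,j\in\mathbb{N}_0$, let $\mu_{ij}(K)=\int_K x_1^i x_2^j\,d(x_1,x_2)$ denote its geometric moments, and for convex bodies $K,L\subset[0,1]^2$ let $\delta_N(K,L)$ denote the Nikodym distance, i.e. the area of the symmetric difference $(K\setminus L)\cup(L\setminus K)$ (the subscript of $\delta_N$ stands for Nikodym and is unrelated to the integer $N$ below). **Theorem.** There exist absolute constants $a_0,a_1>0$ such that the following holds for every $N\in\mathbb{N}_0$, every $\varepsilon\ge 0$ and all convex bodies $K,L\subset[0,1]^2$. If $$\sum_{i,j=0}^N |\mu_{ij}(K)-\mu_{ij}(L)|^2\le \varepsilon^2,$$ then $$\delta_N(K,L)\le \min\left\{a_0(n+1)^2e^{7(n+1)}\varepsilon^2+\frac{a_1}{n+1} : n=0,\ldots,N\right\}.$$ -/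

import Mathlib

open MeasureTheory

/-- The closed unit square `[0,1]²` in the plane `ℝ² = ℝ × ℝ`. -/
def unitSquare : Set (ℝ × ℝ) := Set.Icc (0 : ℝ) 1 ×ˢ Set.Icc (0 : ℝ) 1

/-- A planar convex body: a compact, convex subset of `ℝ²` with nonempty interior. -/
structure IsPlanarConvexBody (K : Set (ℝ × ℝ)) : Prop where
  isCompact : IsCompact K
  convex : Convex ℝ K
  interior_nonempty : (interior K).Nonempty

/-- The geometric moment `μ_ij(K) = ∫_K x₁ ^ i * x₂ ^ j d(x₁, x₂)`. -/
noncomputable def geometricMoment (K : Set (ℝ × ℝ)) (i j : ℕ) : ℝ :=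
  ∫ x in K, x.1 ^ i * x.2 ^ j

/-- The Nikodym distance: the area of the symmetric difference of `K` and `L`. -/
noncomputable def nikodymDist (K L : Set (ℝ × ℝ)) : ℝ :=
  (volume ((K \ L) ∪ (L \ K))).toReal

/-! Write f for the difference of the indicators of K and L. The Nikodym distance is ∫ f² over the
square, and f² ≤ 2fq + (f - q)² for every polynomial q (`nikodymDist_le_of_bipolynomial`). The term
∫ fq is a combination of moment differences, controlled by ε and the coefficients of q. So it
suffices to find q of degree m in each variable with squared L² error O(1/m) and coefficients
exponential in m (`exists_bipolynomial_approximation`).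

Substitute x = (1 - cos θ)/2 in both variables and truncate the double cosine series of f.
Axis-parallel slices of a convex set are intervals, and remain so in θ, hence their k-th cosine
coefficients are O(1/k) and the squared tails O(1/m); `integral_sq_le_sum_cosBasis₂_add` carries
this from slices to the plane. Cosines are Chebyshev polynomials in x, so the truncation is a
polynomial, and the substitution does not increase lengths, so the error bound passes back to the
square. -/

/-! ### Cosine series on (0, π]. -/

/-- Lebesgue measure on `(0, π]`. -/
noncomputable def anglesMeasure : Measure ℝ := volume.restrict (Set.Ioc 0 Real.pi)

instance : IsFiniteMeasure anglesMeasure := by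
  unfold anglesMeasure
  infer_instance

lemma anglesMeasure_real_univ : anglesMeasure.real Set.univ = Real.pi := by
  simp [anglesMeasure, Real.pi_pos.le]

/-- The normalising factor of the `k`-th cosine in `L²(0, π)`. -/
noncomputable def cosScale (k : ℕ) : ℝ := if k = 0 then √(1 / Real.pi) else √(2 / Real.pi)

/-- The orthonormal cosine basis of `L²(0, π)`. -/
noncomputable def cosBasis (k : ℕ) (θ : ℝ) : ℝ := cosScale k * Real.cos (k * θ)

lemma cosScale_nonneg (k : ℕ) : 0 ≤ cosScale k := by
  unfold cosScale
  split_ifs <;> positivity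

lemma cosScale_sq (k : ℕ) : cosScale k ^ 2 = (if k = 0 then 1 else 2) / Real.pi := by
  unfold cosScale
  split_ifs <;> rw [Real.sq_sqrt (by positivity)]

lemma cosScale_le_one (k : ℕ) : cosScale k ≤ 1 := by
  have h : cosScale k ^ 2 ≤ 1 := by
    rw [cosScale_sq, div_le_one Real.pi_pos]
    split_ifs <;> linarith [Real.pi_gt_three]
  nlinarith [cosScale_nonneg k]

lemma abs_cosBasis_le_one (k : ℕ) (θ : ℝ) : |cosBasis k θ| ≤ 1 := by
  rw [cosBasis, abs_mul, abs_of_nonneg (cosScale_nonneg k)]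
  exact mul_le_one₀ (cosScale_le_one k) (abs_nonneg _) (Real.abs_cos_le_one _)

lemma measurable_cosBasis (k : ℕ) : Measurable (cosBasis k) := by
  unfold cosBasis
  fun_prop

lemma Measurable.integrable_of_abs_le {α : Type*} [MeasurableSpace α] {μ : Measure α}
    [IsFiniteMeasure μ] {h : α → ℝ} (hm : Measurable h) {B : ℝ} (hB : ∀ x, |h x| ≤ B) :
    Integrable h μ :=
  Integrable.of_bound hm.aestronglyMeasurable B (Filter.Eventually.of_forall hB)

/-- Even reflection x ↦ h |x| turns cosine integrals on (0, π] into ordinary Fourier coefficients on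
(-π, π], since the sine parts cancel. This makes Parseval for Fourier series available. -/
lemma fourierCoeffOn_comp_abs {h : ℝ → ℝ} (hm : Measurable h) {B : ℝ} (hB : ∀ x, |h x| ≤ B)
    (n : ℤ) :
    fourierCoeffOn (neg_lt_self Real.pi_pos) (fun x => (h |x| : ℂ)) n =
      ((1 / Real.pi * ∫ θ, h θ * Real.cos (n * θ) ∂anglesMeasure : ℝ) : ℂ) := by
  have hint : ∀ (g : ℝ → ℝ) (w : ℝ → ℂ), Measurable g → Continuous w → (∀ x, ‖w x‖ ≤ 1) →
      (∀ x, |g x| ≤ B) → ∀ a b, IntervalIntegrable (fun x => w x * (g x : ℂ)) volume a b := by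
    intro g w hg hw hw1 hgB a b
    constructor <;>
    · refine Integrable.of_bound (by fun_prop) B (Filter.Eventually.of_forall fun x => ?_)
      rw [norm_mul, Complex.norm_real, Real.norm_eq_abs]
      exact (mul_le_mul (hw1 x) (hgB x) (abs_nonneg _) zero_le_one).trans (one_mul B).le
  have hw : ∀ n : ℤ, ∀ x : ℝ, ‖Complex.exp ((n * x : ℝ) * Complex.I)‖ ≤ 1 := fun n x =>
    (Complex.norm_exp_ofReal_mul_I _).le
  have hfour : ∀ x : ℝ, (fourier (-n) (x : AddCircle (Real.pi - -Real.pi)) : ℂ) =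
      Complex.exp ((((-n : ℤ) : ℝ) * x : ℝ) * Complex.I) := by
    intro x
    rw [fourier_coe_apply]
    congr 1
    have : (Real.pi : ℂ) ≠ 0 := by exact_mod_cast Real.pi_ne_zero
    push_cast
    field_simp
    ring
  rw [fourierCoeffOn_eq_integral]
  simp only [hfour, smul_eq_mul]
  rw [← intervalIntegral.integral_add_adjacent_intervals (b := 0)
    (hint (fun x => h |x|) _ (by fun_prop) (by fun_prop) (hw _) (fun x => hB _) _ _)
    (hint (fun x => h |x|) _ (by fun_prop) (by fun_prop) (hw _) (fun x => hB _) _ _)]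
  have hneg : ∫ x in (-Real.pi)..0,
      Complex.exp ((((-n : ℤ) : ℝ) * x : ℝ) * Complex.I) * (h |x| : ℂ) =
      ∫ x in (0 : ℝ)..Real.pi, Complex.exp (((n : ℝ) * x : ℝ) * Complex.I) * (h |x| : ℂ) := by
    have := intervalIntegral.integral_comp_neg (a := 0) (b := Real.pi)
      (fun x => Complex.exp ((((-n : ℤ) : ℝ) * x : ℝ) * Complex.I) * (h |x| : ℂ))
    rw [neg_zero] at this
    rw [← this]
    congr 1
    ext x
    simp
  rw [hneg, ← intervalIntegral.integral_add
    (hint (fun x => h |x|) _ (by fun_prop) (by fun_prop) (hw _) (fun x => hB _) _ _)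
    (hint (fun x => h |x|) _ (by fun_prop) (by fun_prop) (hw _) (fun x => hB _) _ _),
    intervalIntegral.integral_of_le Real.pi_pos.le]
  have hcos : ∀ x ∈ Set.Ioc 0 Real.pi,
      Complex.exp (((n : ℝ) * x : ℝ) * Complex.I) * (h |x| : ℂ) +
        Complex.exp ((((-n : ℤ) : ℝ) * x : ℝ) * Complex.I) * (h |x| : ℂ) =
      ((2 * (h x * Real.cos (n * x)) : ℝ) : ℂ) := by
    intro x hx
    rw [abs_of_pos hx.1]
    push_cast
    rw [Complex.cos]
    ring_nf
  rw [setIntegral_congr_fun measurableSet_Ioc hcos, integral_complex_ofReal,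
    integral_const_mul, Complex.real_smul, ← Complex.ofReal_mul]
  congr 1
  rw [anglesMeasure]
  field_simp
  ring

/-- Parseval's identity for the cosine basis. -/
theorem hasSum_sq_integral_mul_cosBasis {h : ℝ → ℝ} (hm : Measurable h) {B : ℝ}
    (hB : ∀ x, |h x| ≤ B) :
    HasSum (fun k => (∫ θ, h θ * cosBasis k θ ∂anglesMeasure) ^ 2)
      (∫ θ, h θ ^ 2 ∂anglesMeasure) := by
  have hπ := Real.pi_pos
  set c : ℤ → ℝ := fun n => 1 / Real.pi * ∫ θ, h θ * Real.cos (n * θ) ∂anglesMeasure with hc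
  have hceven : ∀ n, c (-n) = c n := by
    intro n
    simp [hc]
  have hL2 : MemLp (fun x : ℝ => (h |x| : ℂ)) 2
      (volume.restrict (Set.Ioc (-Real.pi) Real.pi)) := by
    refine MemLp.of_bound (Measurable.aestronglyMeasurable (by fun_prop)) B (Filter.Eventually.of_forall fun x => ?_)
    rw [Complex.norm_real]
    exact hB _
  have h1 := hasSum_sq_fourierCoeffOn (neg_lt_self hπ) hL2
  simp only [fourierCoeffOn_comp_abs hm hB, Complex.norm_real, Real.norm_eq_abs, sq_abs] at h1
  change HasSum (fun n => c n ^ 2) _ at h1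
  have hval : (Real.pi - -Real.pi)⁻¹ • ∫ x in (-Real.pi)..Real.pi, h |x| ^ 2 =
      1 / Real.pi * ∫ θ, h θ ^ 2 ∂anglesMeasure := by
    have hint : ∀ a b, IntervalIntegrable (fun x => h |x| ^ 2) volume a b := by
      intro a b
      constructor <;>
      · refine Measurable.integrable_of_abs_le (B := B ^ 2) (by fun_prop) fun x => ?_
        rw [abs_pow]
        exact pow_le_pow_left₀ (abs_nonneg _) (hB _) 2
    have hneg : ∫ x in (-Real.pi)..0, h |x| ^ 2 = ∫ x in (0 : ℝ)..Real.pi, h |x| ^ 2 := by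
      have := intervalIntegral.integral_comp_neg (a := 0) (b := Real.pi) (fun x => h |x| ^ 2)
      rw [neg_zero] at this
      rw [← this]
      simp
    rw [← intervalIntegral.integral_add_adjacent_intervals (hint _ 0) (hint 0 _), hneg,
      intervalIntegral.integral_of_le hπ.le, anglesMeasure,
      setIntegral_congr_fun (g := fun x => h x ^ 2) measurableSet_Ioc
        fun x hx => by simp only [abs_of_pos hx.1], smul_eq_mul]
    field_simp
    ring
  rw [hval] at h1
  -- Folding ℤ onto ℕ counts the index 0 twice; the surplus is subtracted in `h4`. This is why
  -- `cosScale` singles out k = 0.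
  have h2 := h1.nat_add_neg
  simp only [hceven] at h2
  have h3 : HasSum (fun k : ℕ => (if k = 0 then 1 else 2) * c k ^ 2)
      (1 / Real.pi * ∫ θ, h θ ^ 2 ∂anglesMeasure) := by
    have h4 := h2.sub (hasSum_ite_eq 0 (c 0 ^ 2))
    rw [add_sub_cancel_right] at h4
    have e : ∀ k : ℕ, (if k = 0 then 1 else 2) * c k ^ 2 =
        c k ^ 2 + c k ^ 2 - if k = 0 then c 0 ^ 2 else 0 := by
      intro k
      by_cases hk : k = 0
      · simp [hk]
      · simp only [hk, if_false]
        ring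
    rw [funext e]
    exact h4
  have h5 := h3.mul_left Real.pi
  have e : ∀ k : ℕ, (∫ θ, h θ * cosBasis k θ ∂anglesMeasure) ^ 2 =
      Real.pi * ((if k = 0 then 1 else 2) * c k ^ 2) := by
    intro k
    have : ∫ θ, h θ * cosBasis k θ ∂anglesMeasure =
        cosScale k * ∫ θ, h θ * Real.cos (k * θ) ∂anglesMeasure := by
      rw [← integral_const_mul]
      refine integral_congr_ae (Filter.Eventually.of_forall fun θ => ?_)
      simp only [cosBasis]
      ring
    rw [this, mul_pow, cosScale_sq, hc]
    simp only [Int.cast_natCast]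
    field_simp
  rw [← mul_assoc, mul_one_div_cancel hπ.ne', one_mul] at h5
  rw [funext e]
  exact h5

lemma integral_cos_intCast_mul (n : ℤ) :
    ∫ θ, Real.cos (n * θ) ∂anglesMeasure = if n = 0 then Real.pi else 0 := by
  rw [anglesMeasure, ← intervalIntegral.integral_of_le Real.pi_pos.le]
  split_ifs with h
  · simp [h]
  · have : (n : ℝ) ≠ 0 := by exact_mod_cast h
    rw [intervalIntegral.integral_comp_mul_left _ this]
    simp [Real.sin_int_mul_pi]

lemma integral_cosBasis_mul_cosBasis (j k : ℕ) :
    ∫ θ, cosBasis j θ * cosBasis k θ ∂anglesMeasure = if j = k then 1 else 0 := by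
  have hint : ∀ n : ℤ, Integrable (fun θ => Real.cos (n * θ)) anglesMeasure := fun n =>
    Measurable.integrable_of_abs_le (by fun_prop) fun x => Real.abs_cos_le_one _
  have h : ∀ θ, cosBasis j θ * cosBasis k θ = cosScale j * cosScale k / 2 *
      (Real.cos (((j + k : ℤ) : ℝ) * θ) + Real.cos (((j - k : ℤ) : ℝ) * θ)) := by
    intro θ
    rw [cosBasis, cosBasis]
    push_cast
    rw [add_mul, sub_mul, Real.cos_add, Real.cos_sub]
    ring
  simp only [h]
  rw [integral_const_mul, integral_add (hint _) (hint _), integral_cos_intCast_mul,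
    integral_cos_intCast_mul]
  have hπ := Real.pi_pos
  by_cases hjk : j = k
  · subst hjk
    have := cosScale_sq j
    rw [← sq, this]
    by_cases hj : j = 0
    · simp [hj]
      field_simp
      norm_num
    · have : (j : ℤ) + j ≠ 0 := by omega
      simp [hj]
      field_simp
  · have h1 : (j : ℤ) + k ≠ 0 := by omega
    have h2 : (j : ℤ) - k ≠ 0 := by omega
    simp [hjk, h1, h2]

/-- The cosine coefficients of the indicator of an interval decay like `1 / k`. -/
lemma abs_setIntegral_cosBasis_le {S : Set ℝ} (hS : IsCompact S) (hc : S.OrdConnected)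
    (hsub : S ⊆ Set.Icc 0 Real.pi) {k : ℕ} (hk : k ≠ 0) :
    |∫ θ in S, cosBasis k θ ∂anglesMeasure| ≤ 2 / k := by
  rcases S.eq_empty_or_nonempty with rfl | hne
  · simp
    positivity
  have hIcc := eq_Icc_of_connected_compact ⟨hne, hc.isPreconnected⟩ hS
  set a := sInf S
  set b := sSup S
  have hab : a ≤ b := by
    by_contra hlt
    rw [hIcc, Set.Icc_eq_empty hlt] at hne
    exact Set.not_nonempty_empty hne
  have ha : 0 ≤ a := (hsub (hIcc ▸ Set.left_mem_Icc.2 hab)).1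
  have hb : b ≤ Real.pi := (hsub (hIcc ▸ Set.right_mem_Icc.2 hab)).2
  have hk' : (k : ℝ) ≠ 0 := by exact_mod_cast hk
  have hres : anglesMeasure.restrict S = volume.restrict (Set.Ioc a b) := by
    rw [anglesMeasure, Measure.restrict_restrict hS.measurableSet, hIcc]
    apply Measure.restrict_congr_set
    have h := (Ioc_ae_eq_Icc (μ := volume) (a := a) (b := b)).symm.inter
      (ae_eq_refl (Set.Ioc 0 Real.pi))
    rwa [Set.inter_eq_left.2 (Set.Ioc_subset_Ioc ha hb)] at h
  rw [hres, ← intervalIntegral.integral_of_le hab]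
  have hcalc : ∫ θ in a..b, cosBasis k θ =
      cosScale k * ((Real.sin (k * b) - Real.sin (k * a)) / k) := by
    simp only [cosBasis]
    rw [intervalIntegral.integral_const_mul, intervalIntegral.integral_comp_mul_left _ hk',
      integral_cos, smul_eq_mul, inv_mul_eq_div]
  rw [hcalc, abs_mul, abs_of_nonneg (cosScale_nonneg k), abs_div, Nat.abs_cast]
  have h2 : |Real.sin (k * b) - Real.sin (k * a)| ≤ 2 := by
    have := abs_sub (Real.sin (k * b)) (Real.sin (k * a))
    linarith [Real.abs_sin_le_one (k * b), Real.abs_sin_le_one (k * a)]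
  calc _ ≤ 1 * (|Real.sin (k * b) - Real.sin (k * a)| / k) := by
        gcongr
        exact cosScale_le_one k
    _ ≤ 2 / k := by
        rw [one_mul]
        gcongr

/-! ### Double cosine series and their truncation. -/

/-- Pythagoras for the projection onto a finite orthonormal family of bounded functions. -/
lemma integral_sq_sub_projection {α ι : Type*} [MeasurableSpace α] {ν : Measure α}
    [IsFiniteMeasure ν] {E : ι → α → ℝ} (hE : ∀ i, Measurable (E i)) (hE1 : ∀ i x, |E i x| ≤ 1)
    [DecidableEq ι] (hon : ∀ i j, ∫ x, E i x * E j x ∂ν = if i = j then 1 else 0)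
    {F : α → ℝ} (hF : Measurable F) (hF1 : ∀ x, |F x| ≤ 1) (s : Finset ι) :
    ∫ x, (F x - ∑ i ∈ s, (∫ y, F y * E i y ∂ν) * E i x) ^ 2 ∂ν =
      ∫ x, F x ^ 2 ∂ν - ∑ i ∈ s, (∫ y, F y * E i y ∂ν) ^ 2 := by
  set c : ι → ℝ := fun i => ∫ y, F y * E i y ∂ν
  change ∫ x, (F x - ∑ i ∈ s, c i * E i x) ^ 2 ∂ν = ∫ x, F x ^ 2 ∂ν - ∑ i ∈ s, c i ^ 2
  have hmul : ∀ {f g : α → ℝ}, Measurable f → Measurable g → (∀ x, |f x| ≤ 1) →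
      (∀ x, |g x| ≤ 1) → Integrable (fun x => f x * g x) ν := by
    intro f g hf hg hf1 hg1
    refine Measurable.integrable_of_abs_le (B := 1) (by fun_prop) fun x => ?_
    rw [abs_mul]
    exact mul_le_one₀ (hf1 x) (abs_nonneg _) (hg1 x)
  have hexpand : ∀ {f : α → ℝ}, Measurable f → (∀ x, |f x| ≤ 1) →
      Integrable (fun x => ∑ i ∈ s, c i * (f x * E i x)) ν := fun hf hf1 =>
    integrable_finsetSum _ fun i _ => (hmul hf (hE i) hf1 (hE1 i)).const_mul _
  have hQE : ∀ j ∈ s, ∫ x, ∑ i ∈ s, c i * (E j x * E i x) ∂ν = c j := by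
    intro j hj
    rw [integral_finsetSum _ fun i _ => (hmul (hE j) (hE i) (hE1 j) (hE1 i)).const_mul _]
    simp only [integral_const_mul, hon]
    simp [hj]
  have hFQ : ∫ x, ∑ i ∈ s, c i * (F x * E i x) ∂ν = ∑ i ∈ s, c i ^ 2 := by
    rw [integral_finsetSum _ fun i _ => (hmul hF (hE i) hF1 (hE1 i)).const_mul _]
    simp only [integral_const_mul, sq]
    rfl
  have hQQ : ∫ x, ∑ j ∈ s, c j * ∑ i ∈ s, c i * (E j x * E i x) ∂ν = ∑ i ∈ s, c i ^ 2 := by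
    rw [integral_finsetSum _ fun j _ => (hexpand (hE j) (hE1 j)).const_mul _]
    refine Finset.sum_congr rfl fun j hj => ?_
    rw [integral_const_mul, hQE j hj, sq]
  have hpt : ∀ x, (F x - ∑ i ∈ s, c i * E i x) ^ 2 =
      (F x * F x - 2 * ∑ i ∈ s, c i * (F x * E i x)) +
        ∑ j ∈ s, c j * ∑ i ∈ s, c i * (E j x * E i x) := by
    intro x
    have h1 : ∑ i ∈ s, c i * (F x * E i x) = F x * ∑ i ∈ s, c i * E i x := by
      rw [Finset.mul_sum]
      exact Finset.sum_congr rfl fun i _ => by ring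
    have h2 : ∑ j ∈ s, c j * ∑ i ∈ s, c i * (E j x * E i x) =
        (∑ i ∈ s, c i * E i x) * ∑ i ∈ s, c i * E i x := by
      rw [Finset.sum_mul]
      refine Finset.sum_congr rfl fun j _ => ?_
      rw [Finset.mul_sum, Finset.mul_sum]
      exact Finset.sum_congr rfl fun i _ => by ring
    rw [h1, h2]
    ring
  have hQQi : Integrable (fun x => ∑ j ∈ s, c j * ∑ i ∈ s, c i * (E j x * E i x)) ν :=
    integrable_finsetSum _ fun j _ => (hexpand (hE j) (hE1 j)).const_mul _
  have hdiff : Integrable (fun x => F x * F x - 2 * ∑ i ∈ s, c i * (F x * E i x)) ν :=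
    (hmul hF hF hF1 hF1).sub ((hexpand hF hF1).const_mul 2)
  simp only [hpt]
  rw [integral_add hdiff hQQi,
    integral_sub (hmul hF hF hF1 hF1) ((hexpand hF hF1).const_mul 2), integral_const_mul,
    hFQ, hQQ]
  simp only [sq]
  ring

/-- The tensor products of the cosine basis. -/
noncomputable def cosBasis₂ (i : ℕ × ℕ) (p : ℝ × ℝ) : ℝ := cosBasis i.1 p.1 * cosBasis i.2 p.2

/-- Lebesgue measure on `(0, π]²`. -/
noncomputable def anglesMeasure₂ : Measure (ℝ × ℝ) := anglesMeasure.prod anglesMeasure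

instance : IsFiniteMeasure anglesMeasure₂ := by
  unfold anglesMeasure₂
  infer_instance

lemma measurable_cosBasis₂ (i : ℕ × ℕ) : Measurable (cosBasis₂ i) := by
  have h1 := measurable_cosBasis i.1
  have h2 := measurable_cosBasis i.2
  unfold cosBasis₂
  fun_prop

lemma abs_cosBasis₂_le_one (i : ℕ × ℕ) (p : ℝ × ℝ) : |cosBasis₂ i p| ≤ 1 := by
  rw [cosBasis₂, abs_mul]
  exact mul_le_one₀ (abs_cosBasis_le_one _ _) (abs_nonneg _) (abs_cosBasis_le_one _ _)

lemma integral_cosBasis₂_mul_cosBasis₂ (i j : ℕ × ℕ) :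
    ∫ p, cosBasis₂ i p * cosBasis₂ j p ∂anglesMeasure₂ = if i = j then 1 else 0 := by
  have h : ∀ p : ℝ × ℝ, cosBasis₂ i p * cosBasis₂ j p =
      (cosBasis i.1 p.1 * cosBasis j.1 p.1) * (cosBasis i.2 p.2 * cosBasis j.2 p.2) := by
    intro p
    simp only [cosBasis₂]
    ring
  simp only [h]
  rw [anglesMeasure₂, integral_prod_mul (fun x => cosBasis i.1 x * cosBasis j.1 x)
    (fun x => cosBasis i.2 x * cosBasis j.2 x), integral_cosBasis_mul_cosBasis,
    integral_cosBasis_mul_cosBasis]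
  by_cases h1 : i.1 = j.1 <;> by_cases h2 : i.2 = j.2 <;> simp [Prod.ext_iff, h1, h2]

lemma abs_integral_anglesMeasure_le {h : ℝ → ℝ} {B : ℝ} (hB : ∀ x, |h x| ≤ B) :
    |∫ x, h x ∂anglesMeasure| ≤ B * Real.pi := by
  have := norm_integral_le_of_norm_le_const (μ := anglesMeasure) (f := h)
    (Filter.Eventually.of_forall hB)
  rwa [anglesMeasure_real_univ] at this

lemma integral_sq_le_sum_add {h : ℝ → ℝ} (hm : Measurable h) {B : ℝ} (hB : ∀ x, |h x| ≤ B)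
    {M : ℕ} {τ : ℝ}
    (hτ : ∀ n, ∑ k ∈ Finset.Ico M n, (∫ x, h x * cosBasis k x ∂anglesMeasure) ^ 2 ≤ τ) :
    ∫ x, h x ^ 2 ∂anglesMeasure ≤
      ∑ k ∈ Finset.range M, (∫ x, h x * cosBasis k x ∂anglesMeasure) ^ 2 + τ := by
  refine le_of_tendsto (hasSum_sq_integral_mul_cosBasis hm hB).tendsto_sum_nat ?_
  filter_upwards [Filter.eventually_ge_atTop M] with n hn
  rw [← Finset.sum_range_add_sum_Ico _ hn]
  exact add_le_add_right (hτ n) _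

/-- If the one-dimensional cosine coefficients of all slices of `F` have tails at most `τ`, then
the two-dimensional truncated cosine coefficients capture the energy of `F` up to `2πτ`. -/
theorem integral_sq_le_sum_cosBasis₂_add {F : ℝ × ℝ → ℝ} (hF : Measurable F)
    (hF1 : ∀ p, |F p| ≤ 1) {M : ℕ} {t : ℕ → ℝ} {τ : ℝ}
    (h1 : ∀ y, ∀ k ≥ M, (∫ x, F (x, y) * cosBasis k x ∂anglesMeasure) ^ 2 ≤ t k)
    (h2 : ∀ x, ∀ k ≥ M, (∫ y, F (x, y) * cosBasis k y ∂anglesMeasure) ^ 2 ≤ t k)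
    (hτ : ∀ n, ∑ k ∈ Finset.Ico M n, t k ≤ τ) :
    ∫ p, F p ^ 2 ∂anglesMeasure₂ ≤
      ∑ i ∈ Finset.range M ×ˢ Finset.range M,
        (∫ p, F p * cosBasis₂ i p ∂anglesMeasure₂) ^ 2 + 2 * Real.pi * τ := by
  have hπ := Real.pi_pos
  have he := measurable_cosBasis
  have hmulB : ∀ {f g : ℝ}, |f| ≤ 1 → |g| ≤ 1 → |f * g| ≤ 1 := fun hf hg => by
    rw [abs_mul]
    exact mul_le_one₀ hf (abs_nonneg _) hg
  set a : ℕ → ℝ → ℝ := fun k y => ∫ x, F (x, y) * cosBasis k x ∂anglesMeasure with ha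
  set b : ℕ → ℝ → ℝ := fun k x => ∫ y, F (x, y) * cosBasis k y ∂anglesMeasure with hb
  have ham : ∀ k, Measurable (a k) := fun k =>
    (StronglyMeasurable.integral_prod_left' (μ := anglesMeasure)
      (f := fun p : ℝ × ℝ => F p * cosBasis k p.1)
      (Measurable.stronglyMeasurable (by have := he k; fun_prop))).measurable
  have hbm : ∀ k, Measurable (b k) := fun k =>
    (StronglyMeasurable.integral_prod_right' (ν := anglesMeasure)
      (f := fun p : ℝ × ℝ => F p * cosBasis k p.2)
      (Measurable.stronglyMeasurable (by have := he k; fun_prop))).measurable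
  have haB : ∀ k y, |a k y| ≤ Real.pi := fun k y =>
    (abs_integral_anglesMeasure_le fun x => hmulB (hF1 _) (abs_cosBasis_le_one _ _)).trans
      (one_mul _).le
  have hbB : ∀ k y, |b k y| ≤ Real.pi := fun k y =>
    (abs_integral_anglesMeasure_le fun x => hmulB (hF1 _) (abs_cosBasis_le_one _ _)).trans
      (one_mul _).le
  have hsq : ∀ {f : ℝ → ℝ}, Measurable f → (∀ x, |f x| ≤ Real.pi) →
      Integrable (fun x => f x ^ 2) anglesMeasure := fun hf hfB => by
    refine Measurable.integrable_of_abs_le (B := Real.pi ^ 2) (by fun_prop) fun x => ?_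
    rw [abs_pow]
    exact pow_le_pow_left₀ (abs_nonneg _) (hfB x) 2
  set c : ℕ → ℕ → ℝ := fun i j => ∫ p, F p * cosBasis₂ (i, j) p ∂anglesMeasure₂ with hc
  have hcint : ∀ i j, Integrable (fun p => F p * cosBasis₂ (i, j) p)
      (anglesMeasure.prod anglesMeasure) := fun i j =>
    Measurable.integrable_of_abs_le (B := 1)
      (by have := measurable_cosBasis₂ (i, j); fun_prop)
      fun p => hmulB (hF1 p) (abs_cosBasis₂_le_one _ _)
  have hca : ∀ i j, c i j = ∫ y, a i y * cosBasis j y ∂anglesMeasure := by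
    intro i j
    simp only [hc, anglesMeasure₂]
    rw [integral_prod_symm _ (hcint i j)]
    congr 1
    ext y
    rw [ha, ← integral_mul_const]
    simp only [cosBasis₂, mul_assoc]
  have hcb : ∀ i j, c i j = ∫ x, b j x * cosBasis i x ∂anglesMeasure := by
    intro i j
    simp only [hc, anglesMeasure₂]
    rw [integral_prod _ (hcint i j)]
    congr 1
    ext x
    rw [hb, ← integral_mul_const]
    simp only [cosBasis₂, mul_assoc]
    congr 1
    ext y
    ring
  have hslice : ∀ y, ∫ x, F (x, y) ^ 2 ∂anglesMeasure ≤
      ∑ k ∈ Finset.range M, a k y ^ 2 + τ := fun y =>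
    integral_sq_le_sum_add (by fun_prop) (fun x => hF1 _) fun n =>
      (Finset.sum_le_sum fun k hk => h1 y k (Finset.mem_Ico.1 hk).1).trans (hτ n)
  have hFsq : Integrable (fun p => F p ^ 2) (anglesMeasure.prod anglesMeasure) :=
    Measurable.integrable_of_abs_le (B := 1) (by fun_prop) fun p => by
      rw [sq]
      exact hmulB (hF1 p) (hF1 p)
  have hconst : ∀ r : ℝ, ∫ _, r ∂anglesMeasure = Real.pi * r := fun r => by
    rw [integral_const, anglesMeasure_real_univ, smul_eq_mul]
  -- Truncation in the first variable: the slice estimate is integrated over y, an interval of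
  -- length π.
  have hstep1 : ∫ p, F p ^ 2 ∂anglesMeasure₂ ≤
      ∑ k ∈ Finset.range M, ∫ y, a k y ^ 2 ∂anglesMeasure + Real.pi * τ := by
    rw [anglesMeasure₂, integral_prod_symm _ hFsq]
    calc _ ≤ ∫ y, (∑ k ∈ Finset.range M, a k y ^ 2 + τ) ∂anglesMeasure :=
          integral_mono hFsq.integral_prod_right
            ((integrable_finsetSum _ fun k _ => hsq (ham k) (haB k)).add (integrable_const _))
            hslice
      _ = _ := by
          rw [integral_add (integrable_finsetSum _ fun k _ => hsq (ham k) (haB k))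
            (integrable_const _), integral_finsetSum _ fun k _ => hsq (ham k) (haB k), hconst]
  -- Bessel in x, applied to `b j`, bounds a whole column of coefficients at once. Estimating the
  -- tails of the M functions `a k` one by one would cost an extra factor M.
  have hcol : ∀ j ≥ M, ∑ i ∈ Finset.range M, c i j ^ 2 ≤ Real.pi * t j := by
    intro j hj
    calc ∑ i ∈ Finset.range M, c i j ^ 2 ≤ ∫ x, b j x ^ 2 ∂anglesMeasure := by
          simp only [hcb]
          exact sum_le_hasSum _ (fun _ _ => sq_nonneg _)
            (hasSum_sq_integral_mul_cosBasis (hbm j) (hbB j))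
      _ ≤ ∫ _, t j ∂anglesMeasure :=
          integral_mono (hsq (hbm j) (hbB j)) (integrable_const _) fun x => h2 x j hj
      _ = _ := hconst _
  have hstep2 : ∑ k ∈ Finset.range M, ∫ y, a k y ^ 2 ∂anglesMeasure ≤
      ∑ i ∈ Finset.range M, ∑ j ∈ Finset.range M, c i j ^ 2 + Real.pi * τ := by
    have hlim : Filter.Tendsto
        (fun n => ∑ i ∈ Finset.range M, ∑ j ∈ Finset.range n, c i j ^ 2) Filter.atTop
        (nhds (∑ k ∈ Finset.range M, ∫ y, a k y ^ 2 ∂anglesMeasure)) := by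
      refine tendsto_finsetSum _ fun i _ => ?_
      simp only [hca]
      exact (hasSum_sq_integral_mul_cosBasis (ham i) (haB i)).tendsto_sum_nat
    refine le_of_tendsto hlim ?_
    filter_upwards [Filter.eventually_ge_atTop M] with n hn
    simp only [← Finset.sum_range_add_sum_Ico _ hn]
    rw [Finset.sum_add_distrib, Finset.sum_comm (t := Finset.Ico M n)]
    refine add_le_add_right ?_ _
    calc _ ≤ ∑ j ∈ Finset.Ico M n, Real.pi * t j :=
          Finset.sum_le_sum fun j hj => hcol j (Finset.mem_Ico.1 hj).1
      _ ≤ _ := by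
          rw [← Finset.mul_sum]
          exact mul_le_mul_of_nonneg_left (hτ n) hπ.le
  rw [Finset.sum_product]
  change _ ≤ ∑ i ∈ Finset.range M, ∑ j ∈ Finset.range M, c i j ^ 2 + _
  linarith

/-! ### The substitution x = (1 - cos θ)/2. -/

/-- The map `θ ↦ (1 - cos θ) / 2` from `[0, π]` onto `[0, 1]`. -/
noncomputable def versineHalf (θ : ℝ) : ℝ := (1 - Real.cos θ) / 2

lemma continuous_versineHalf : Continuous versineHalf := by
  unfold versineHalf
  fun_prop

lemma versineHalf_mem_Icc (θ : ℝ) : versineHalf θ ∈ Set.Icc (0 : ℝ) 1 := by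
  rw [versineHalf]
  constructor <;> linarith [Real.neg_one_le_cos θ, Real.cos_le_one θ]

lemma monotoneOn_versineHalf : MonotoneOn versineHalf (Set.Icc 0 Real.pi) := by
  intro x hx y hy hxy
  have := Real.strictAntiOn_cos.antitoneOn hx hy hxy
  rw [versineHalf, versineHalf]
  linarith

lemma lipschitzWith_versineHalf : LipschitzWith 1 versineHalf := by
  refine lipschitzWith_of_nnnorm_deriv_le (by unfold versineHalf; fun_prop) fun x => ?_
  have : HasDerivAt versineHalf (-(-Real.sin x) / 2) x :=
    ((Real.hasDerivAt_cos x).const_sub 1).div_const 2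
  rw [this.deriv, ← NNReal.coe_le_coe, coe_nnnorm, Real.norm_eq_abs, neg_neg, abs_div]
  have := Real.abs_sin_le_one x
  norm_num
  linarith

/-- A 1-Lipschitz map does not increase length (one-dimensional Hausdorff measure), and every point
of (0, 1] is attained at arccos (1 - 2x) in (0, π]. -/
lemma volume_restrict_Icc_le_map_versineHalf :
    volume.restrict (Set.Icc (0 : ℝ) 1) ≤ anglesMeasure.map versineHalf := by
  rw [← restrict_Ioc_eq_restrict_Icc]
  refine Measure.le_iff.2 fun A hA => ?_
  rw [Measure.map_apply continuous_versineHalf.measurable hA, anglesMeasure,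
    Measure.restrict_apply hA,
    Measure.restrict_apply (continuous_versineHalf.measurable hA)]
  calc volume (A ∩ Set.Ioc 0 1)
      ≤ volume (versineHalf '' (versineHalf ⁻¹' A ∩ Set.Ioc 0 Real.pi)) := by
        refine measure_mono fun x hx => ?_
        have hval : versineHalf (Real.arccos (1 - 2 * x)) = x := by
          rw [versineHalf, Real.cos_arccos (by linarith [hx.2.2]) (by linarith [hx.2.1])]
          ring
        refine ⟨Real.arccos (1 - 2 * x), ⟨?_, ?_, Real.arccos_le_pi _⟩, hval⟩
        · rw [Set.mem_preimage, hval]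
          exact hx.1
        · exact Real.arccos_pos.2 (by linarith [hx.2.1])
    _ ≤ volume (versineHalf ⁻¹' A ∩ Set.Ioc 0 Real.pi) := by
        have := (lipschitzWith_versineHalf.lipschitzOnWith
          (s := versineHalf ⁻¹' A ∩ Set.Ioc 0 Real.pi)).hausdorffMeasure_image_le zero_le_one
        simpa [hausdorffMeasure_real] using this

lemma volume_restrict_unitSquare_le :
    volume.restrict unitSquare ≤ anglesMeasure₂.map (Prod.map versineHalf versineHalf) := by
  have hm := continuous_versineHalf.measurable
  rw [unitSquare, Measure.volume_eq_prod, ← Measure.prod_restrict, anglesMeasure₂,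
    ← Measure.map_prod_map _ _ hm hm]
  exact Measure.prod_mono volume_restrict_Icc_le_map_versineHalf
    volume_restrict_Icc_le_map_versineHalf

/-! ### Chebyshev polynomials and the size of their coefficients. -/

/-- The shifted Chebyshev polynomial, which takes the value `cos (k θ)` at `(1 - cos θ) / 2`. -/
noncomputable def shiftedChebyshev (k : ℕ) : Polynomial ℝ :=
  (Polynomial.Chebyshev.T ℝ k).comp (1 - 2 * Polynomial.X)

lemma eval_shiftedChebyshev (k : ℕ) (θ : ℝ) :
    (shiftedChebyshev k).eval (versineHalf θ) = Real.cos (k * θ) := by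
  have h := Polynomial.Chebyshev.T_real_cos θ k
  rw [shiftedChebyshev, Polynomial.eval_comp]
  have : Polynomial.eval (versineHalf θ) (1 - 2 * Polynomial.X : Polynomial ℝ) = Real.cos θ := by
    simp [versineHalf]
    ring
  rw [this, h]
  simp

lemma shiftedChebyshev_add_two (k : ℕ) :
    shiftedChebyshev (k + 2) =
      2 * shiftedChebyshev (k + 1) - 4 * (shiftedChebyshev (k + 1) * Polynomial.X) -
        shiftedChebyshev k := by
  simp only [shiftedChebyshev]
  have := Polynomial.Chebyshev.T_add_two ℝ (k : ℤ)
  push_cast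
  rw [this]
  simp
  ring

lemma natDegree_shiftedChebyshev_le (k : ℕ) : (shiftedChebyshev k).natDegree ≤ k := by
  have h1 : (1 - 2 * Polynomial.X : Polynomial ℝ).natDegree ≤ 1 := by compute_degree
  have h2 : (Polynomial.Chebyshev.T ℝ k).natDegree ≤ k := by simp
  calc _ ≤ _ := Polynomial.natDegree_comp_le
    _ ≤ k * 1 := Nat.mul_le_mul h2 h1
    _ = k := mul_one k

/-- By the three-term recurrence, the induction closes because 2·7 + 4·7 + 1 = 43 ≤ 7². -/
lemma abs_coeff_shiftedChebyshev_le (k a : ℕ) : |(shiftedChebyshev k).coeff a| ≤ 7 ^ k := by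
  induction k using Nat.twoStepInduction generalizing a with
  | zero =>
    simp only [shiftedChebyshev, Nat.cast_zero, Polynomial.Chebyshev.T_zero,
      Polynomial.one_comp, Polynomial.coeff_one, pow_zero]
    split_ifs <;> simp
  | one =>
    have : shiftedChebyshev 1 = 1 - Polynomial.C 2 * Polynomial.X := by
      simp [shiftedChebyshev]
      rfl
    rw [this, Polynomial.coeff_sub, Polynomial.coeff_C_mul, Polynomial.coeff_one,
      Polynomial.coeff_X]
    split_ifs <;> norm_num
  | more k ih0 ih1 =>
    have hX : |(shiftedChebyshev (k + 1) * Polynomial.X).coeff a| ≤ 7 ^ (k + 1) := by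
      cases a with
      | zero => simp
      | succ a =>
        rw [Polynomial.coeff_mul_X]
        exact ih1 a
    have h := shiftedChebyshev_add_two k
    rw [show (2 : Polynomial ℝ) = Polynomial.C 2 from rfl,
      show (4 : Polynomial ℝ) = Polynomial.C 4 from rfl] at h
    rw [h, Polynomial.coeff_sub, Polynomial.coeff_sub, Polynomial.coeff_C_mul,
      Polynomial.coeff_C_mul]
    have h0 := abs_le.1 (ih0 a)
    have h1 := abs_le.1 (ih1 a)
    have h2 := abs_le.1 hX
    have hp : (0 : ℝ) < 7 ^ k := by positivity
    rw [pow_succ] at h1 h2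
    rw [pow_add]
    rw [abs_le]
    constructor <;> linarith

/-! ### Cosine coefficients of slices of convex sets. -/

lemma Convex.ordConnected_versineHalf_preimage {X : Set ℝ} (hX : Convex ℝ X) :
    (Set.Icc 0 Real.pi ∩ versineHalf ⁻¹' X).OrdConnected := by
  refine ⟨fun x hx y hy z hz => ?_⟩
  have hz' : z ∈ Set.Icc 0 Real.pi := ⟨hx.1.1.trans hz.1, hz.2.trans hy.1.2⟩
  exact ⟨hz', hX.ordConnected.out hx.2 hy.2
    ⟨monotoneOn_versineHalf hx.1 hz' hz.1, monotoneOn_versineHalf hz' hy.1 hz.2⟩⟩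

lemma abs_integral_indicator_versineHalf_le {X : Set ℝ} (hX : Convex ℝ X) (hXc : IsClosed X)
    {k : ℕ} (hk : k ≠ 0) :
    |∫ θ, X.indicator 1 (versineHalf θ) * cosBasis k θ ∂anglesMeasure| ≤ 2 / k := by
  set S := Set.Icc 0 Real.pi ∩ versineHalf ⁻¹' X with hS
  have hcomp : IsCompact S :=
    isCompact_Icc.inter_right (hXc.preimage continuous_versineHalf)
  have heq : ∫ θ, X.indicator 1 (versineHalf θ) * cosBasis k θ ∂anglesMeasure =
      ∫ θ in S, cosBasis k θ ∂anglesMeasure := by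
    rw [← integral_indicator hcomp.measurableSet, anglesMeasure]
    refine setIntegral_congr_fun measurableSet_Ioc fun θ hθ => ?_
    have hmem : θ ∈ S ↔ versineHalf θ ∈ X := by
      simp [hS, hθ.1.le, hθ.2]
    by_cases h : versineHalf θ ∈ X
    · simp [h, hmem.2 h]
    · simp [h, mt hmem.1 h]
  rw [heq]
  exact abs_setIntegral_cosBasis_le hcomp hX.ordConnected_versineHalf_preimage
    Set.inter_subset_left hk

/-- The difference of the indicator functions of two planar sets. -/
noncomputable def indicatorDiff (K L : Set (ℝ × ℝ)) (p : ℝ × ℝ) : ℝ :=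
  K.indicator 1 p - L.indicator 1 p

lemma measurable_indicatorDiff {K L : Set (ℝ × ℝ)} (hK : MeasurableSet K)
    (hL : MeasurableSet L) : Measurable (indicatorDiff K L) :=
  (measurable_one.indicator hK).sub (measurable_one.indicator hL)

lemma abs_indicatorDiff_le_one (K L : Set (ℝ × ℝ)) (p : ℝ × ℝ) : |indicatorDiff K L p| ≤ 1 := by
  by_cases h1 : p ∈ K <;> by_cases h2 : p ∈ L <;> simp [indicatorDiff, h1, h2]

lemma indicatorDiff_sq (K L : Set (ℝ × ℝ)) (p : ℝ × ℝ) :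
    indicatorDiff K L p ^ 2 = ((K \ L) ∪ (L \ K)).indicator 1 p := by
  by_cases h1 : p ∈ K <;> by_cases h2 : p ∈ L <;> simp [indicatorDiff, h1, h2]

lemma Convex.section_left {K : Set (ℝ × ℝ)} (hK : Convex ℝ K) (y : ℝ) :
    Convex ℝ {x | (x, y) ∈ K} := by
  intro x hx z hz a b ha hb hab
  have := hK hx hz ha hb hab
  simpa [← add_mul, hab] using this

lemma Convex.section_right {K : Set (ℝ × ℝ)} (hK : Convex ℝ K) (x : ℝ) :
    Convex ℝ {y | (x, y) ∈ K} := by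
  intro y hy z hz a b ha hb hab
  have := hK hy hz ha hb hab
  simpa [← add_mul, hab] using this

/-- Each of the two intervals contributes at most 2/k, and (4/k)² = 16/k². -/
lemma sq_integral_section_le {X Y : Set ℝ} (hX : Convex ℝ X) (hXc : IsClosed X)
    (hY : Convex ℝ Y) (hYc : IsClosed Y) {k : ℕ} (hk : k ≠ 0) :
    (∫ θ, (X.indicator 1 (versineHalf θ) - Y.indicator 1 (versineHalf θ)) * cosBasis k θ
      ∂anglesMeasure) ^ 2 ≤ 16 * ((k : ℝ) ^ 2)⁻¹ := by
  have hint : ∀ {Z : Set ℝ}, IsClosed Z → Integrable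
      (fun θ => Z.indicator (1 : ℝ → ℝ) (versineHalf θ) * cosBasis k θ) anglesMeasure := by
    intro Z hZ
    have h1 : Measurable (Z.indicator (1 : ℝ → ℝ)) :=
      measurable_one.indicator hZ.measurableSet
    have h2 := measurable_cosBasis k
    have h3 := continuous_versineHalf.measurable
    refine Measurable.integrable_of_abs_le (B := 1) ((h1.comp h3).mul h2) fun θ => ?_
    rw [abs_mul]
    refine mul_le_one₀ ?_ (abs_nonneg _) (abs_cosBasis_le_one _ _)
    by_cases h : versineHalf θ ∈ Z <;> simp [h]
  simp only [sub_mul]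
  rw [integral_sub (hint hXc) (hint hYc), ← sq_abs]
  have h1 := abs_integral_indicator_versineHalf_le hX hXc hk
  have h2 := abs_integral_indicator_versineHalf_le hY hYc hk
  have hk' : (0 : ℝ) < k := by exact_mod_cast Nat.pos_of_ne_zero hk
  calc _ ≤ (2 / (k : ℝ) + 2 / k) ^ 2 :=
        pow_le_pow_left₀ (abs_nonneg _) ((abs_sub _ _).trans (add_le_add h1 h2)) 2
    _ = _ := by
        field_simp
        norm_num

/-! ### Polynomial approximation of the difference of indicators. -/

/-- The polynomial in two variables with coefficients `d a b`, of degree at most `m` in each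
variable. -/
noncomputable def bipolynomial (m : ℕ) (d : ℕ → ℕ → ℝ) (p : ℝ × ℝ) : ℝ :=
  ∑ a ∈ Finset.range (m + 1), ∑ b ∈ Finset.range (m + 1), d a b * (p.1 ^ a * p.2 ^ b)

lemma continuous_bipolynomial (m : ℕ) (d : ℕ → ℕ → ℝ) : Continuous (bipolynomial m d) := by
  unfold bipolynomial
  fun_prop

/-- A combination of tensor products of cosines is a polynomial in `(1 - cos θ) / 2` and
`(1 - cos φ) / 2`, with exponentially bounded coefficients. -/
lemma exists_bipolynomial_eq_sum_cosBasis₂ (m : ℕ) {c : ℕ × ℕ → ℝ} {C : ℝ} (hC : ∀ i, |c i| ≤ C) :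
    ∃ d : ℕ → ℕ → ℝ, (∀ a b, |d a b| ≤ C * ((m : ℝ) + 1) ^ 2 * 49 ^ m) ∧
      ∀ p, bipolynomial m d (Prod.map versineHalf versineHalf p) =
        ∑ i ∈ Finset.range (m + 1) ×ˢ Finset.range (m + 1), c i * cosBasis₂ i p := by
  refine ⟨fun a b => ∑ i ∈ Finset.range (m + 1) ×ˢ Finset.range (m + 1),
    c i * (cosScale i.1 * (shiftedChebyshev i.1).coeff a) *
      (cosScale i.2 * (shiftedChebyshev i.2).coeff b), fun a b => ?_, fun p => ?_⟩
  · have hC0 : 0 ≤ C := (abs_nonneg _).trans (hC 0)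
    have hcoeff : ∀ k a, k ∈ Finset.range (m + 1) →
        |cosScale k * (shiftedChebyshev k).coeff a| ≤ 7 ^ m := by
      intro k a hk
      rw [abs_mul, abs_of_nonneg (cosScale_nonneg k)]
      calc _ ≤ 1 * (7 : ℝ) ^ k :=
            mul_le_mul (cosScale_le_one k) (abs_coeff_shiftedChebyshev_le k a) (abs_nonneg _)
              zero_le_one
        _ ≤ 7 ^ m := by
            rw [one_mul]
            exact pow_le_pow_right₀ (by norm_num) (Nat.lt_succ_iff.1 (Finset.mem_range.1 hk))
    calc _ ≤ ∑ i ∈ Finset.range (m + 1) ×ˢ Finset.range (m + 1), C * 7 ^ m * 7 ^ m := by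
          refine (Finset.abs_sum_le_sum_abs _ _).trans (Finset.sum_le_sum fun i hi => ?_)
          obtain ⟨h1, h2⟩ := Finset.mem_product.1 hi
          rw [abs_mul, abs_mul]
          have := hcoeff i.1 a h1
          have := hcoeff i.2 b h2
          have := hC i
          gcongr
      _ = _ := by
          rw [Finset.sum_const, Finset.card_product, Finset.card_range, nsmul_eq_mul,
            show (49 : ℝ) = 7 * 7 by norm_num, mul_pow]
          push_cast
          ring
  · have hcos : ∀ k ∈ Finset.range (m + 1), ∀ θ, cosBasis k θ =
        ∑ a ∈ Finset.range (m + 1),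
          cosScale k * (shiftedChebyshev k).coeff a * versineHalf θ ^ a := by
      intro k hk θ
      rw [cosBasis, ← eval_shiftedChebyshev, Polynomial.eval_eq_sum_range'
        ((natDegree_shiftedChebyshev_le k).trans_lt (Finset.mem_range.1 hk)), Finset.mul_sum]
      exact Finset.sum_congr rfl fun a _ => (mul_assoc _ _ _).symm
    have hterm : ∀ i ∈ Finset.range (m + 1) ×ˢ Finset.range (m + 1), c i * cosBasis₂ i p =
        ∑ a ∈ Finset.range (m + 1), ∑ b ∈ Finset.range (m + 1),
          c i * (cosScale i.1 * (shiftedChebyshev i.1).coeff a) *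
            (cosScale i.2 * (shiftedChebyshev i.2).coeff b) *
              (versineHalf p.1 ^ a * versineHalf p.2 ^ b) := by
      intro i hi
      obtain ⟨h1, h2⟩ := Finset.mem_product.1 hi
      rw [cosBasis₂, hcos _ h1, hcos _ h2, Finset.sum_mul_sum, Finset.mul_sum]
      refine Finset.sum_congr rfl fun a _ => ?_
      rw [Finset.mul_sum]
      exact Finset.sum_congr rfl fun b _ => by ring
    rw [Finset.sum_congr rfl hterm, Finset.sum_comm]
    refine Finset.sum_congr rfl fun a _ => ?_
    rw [Finset.sum_comm]
    refine Finset.sum_congr rfl fun b _ => ?_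
    rw [Finset.sum_mul]
    rfl

/-- The difference of the indicators of two closed convex sets is approximated on the unit square
by polynomials of degree `m` in each variable, with squared `L²` error `O(1 / m)` and
exponentially bounded coefficients. -/
theorem exists_bipolynomial_approximation {K L : Set (ℝ × ℝ)} (hK : Convex ℝ K)
    (hKc : IsClosed K) (hL : Convex ℝ L) (hLc : IsClosed L) (m : ℕ) :
    ∃ d : ℕ → ℕ → ℝ, (∀ a b, |d a b| ≤ 16 * ((m : ℝ) + 1) ^ 2 * 49 ^ m) ∧
      ∫ p in unitSquare, (indicatorDiff K L p - bipolynomial m d p) ^ 2 ≤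
        256 / ((m : ℝ) + 1) := by
  have hπ := Real.pi_pos
  have hπ4 := Real.pi_le_four
  set Ψ : ℝ × ℝ → ℝ × ℝ := Prod.map versineHalf versineHalf with hΨ
  have hΨm : Measurable Ψ :=
    (continuous_versineHalf.prodMap continuous_versineHalf).measurable
  set F : ℝ × ℝ → ℝ := fun p => indicatorDiff K L (Ψ p) with hF
  have hfm := measurable_indicatorDiff hKc.measurableSet hLc.measurableSet
  have hFm : Measurable F := hfm.comp hΨm
  have hF1 : ∀ p, |F p| ≤ 1 := fun p => abs_indicatorDiff_le_one _ _ _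
  have huniv : anglesMeasure₂.real Set.univ = Real.pi * Real.pi := by
    rw [anglesMeasure₂, ← Set.univ_prod_univ, measureReal_prod_prod, anglesMeasure_real_univ]
  -- The integrand is at most 1 in absolute value and the total mass is π² ≤ 16.
  have hcB : ∀ i, |∫ p, F p * cosBasis₂ i p ∂anglesMeasure₂| ≤ 16 := by
    intro i
    have := norm_integral_le_of_norm_le_const (μ := anglesMeasure₂) (C := 1)
      (f := fun p => F p * cosBasis₂ i p) (Filter.Eventually.of_forall fun p => by
        rw [Real.norm_eq_abs, abs_mul]
        exact mul_le_one₀ (hF1 p) (abs_nonneg _) (abs_cosBasis₂_le_one _ _))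
    rw [huniv, Real.norm_eq_abs] at this
    nlinarith
  obtain ⟨d, hd, hdQ⟩ := exists_bipolynomial_eq_sum_cosBasis₂ m hcB
  refine ⟨d, hd, ?_⟩
  have hk0 : ∀ k ≥ m + 1, k ≠ 0 := fun k hk => by omega
  -- Here τ comes from the bound 2/(m + 1) on partial sums of 1/k² over k > m. The resulting loss
  -- 2πτ = 64π/(m + 1) is at most 256/(m + 1).
  have htail := integral_sq_le_sum_cosBasis₂_add hFm hF1 (M := m + 1)
    (t := fun k => 16 * ((k : ℝ) ^ 2)⁻¹) (τ := 16 * (2 / ((m : ℝ) + 1)))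
    (fun y k hk => sq_integral_section_le (hK.section_left (versineHalf y))
      (hKc.preimage (by fun_prop)) (hL.section_left (versineHalf y))
      (hLc.preimage (by fun_prop)) (hk0 k hk))
    (fun x k hk => sq_integral_section_le (hK.section_right (versineHalf x))
      (hKc.preimage (by fun_prop)) (hL.section_right (versineHalf x))
      (hLc.preimage (by fun_prop)) (hk0 k hk))
    (fun n => by
      rw [← Finset.mul_sum]
      exact mul_le_mul_of_nonneg_left (sum_Ioo_inv_sq_le m n) (by norm_num))
  have hproj := integral_sq_sub_projection measurable_cosBasis₂ abs_cosBasis₂_le_one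
    integral_cosBasis₂_mul_cosBasis₂ hFm hF1 (Finset.range (m + 1) ×ˢ Finset.range (m + 1))
  have hqm := (continuous_bipolynomial m d).measurable
  have hgm : Measurable fun p => (indicatorDiff K L p - bipolynomial m d p) ^ 2 := by fun_prop
  have hint : Integrable (fun p => (indicatorDiff K L (Ψ p) - bipolynomial m d (Ψ p)) ^ 2)
      anglesMeasure₂ := by
    obtain ⟨B, hB⟩ := (isCompact_Icc (a := (0 : ℝ)) (b := 1)).prod
      (isCompact_Icc (a := (0 : ℝ)) (b := 1)) |>.exists_bound_of_continuousOn
        (continuous_bipolynomial m d).continuousOn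
    refine Measurable.integrable_of_abs_le (B := (1 + B) ^ 2) (hgm.comp hΨm) fun p => ?_
    rw [abs_pow]
    refine pow_le_pow_left₀ (abs_nonneg _) ((abs_sub _ _).trans (add_le_add (hF1 p) ?_)) 2
    exact hB _ ⟨versineHalf_mem_Icc _, versineHalf_mem_Icc _⟩
  -- Lebesgue measure on the square is dominated by the pushforward and the integrand is
  -- nonnegative, so no Jacobian is needed.
  calc _ ≤ ∫ p, (indicatorDiff K L p - bipolynomial m d p) ^ 2 ∂(anglesMeasure₂.map Ψ) :=
        integral_mono_measure volume_restrict_unitSquare_le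
          (Filter.Eventually.of_forall fun _ => sq_nonneg _)
          ((integrable_map_measure hgm.aestronglyMeasurable hΨm.aemeasurable).2 hint)
    _ = ∫ p, (indicatorDiff K L (Ψ p) - bipolynomial m d (Ψ p)) ^ 2 ∂anglesMeasure₂ :=
        integral_map hΨm.aemeasurable hgm.aestronglyMeasurable
    _ ≤ 2 * Real.pi * (16 * (2 / ((m : ℝ) + 1))) := by
        have hdQ' : ∀ p, bipolynomial m d (Ψ p) = _ := hdQ
        simp only [hdQ']
        change ∫ p, (F p - _) ^ 2 ∂anglesMeasure₂ ≤ _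
        linarith
    _ = 64 * Real.pi / ((m : ℝ) + 1) := by ring
    _ ≤ 256 / ((m : ℝ) + 1) := by
        gcongr
        linarith

/-! ### From moments to the Nikodym distance. -/

lemma nikodymDist_eq_integral {K L : Set (ℝ × ℝ)} (hK : MeasurableSet K) (hL : MeasurableSet L)
    (hKs : K ⊆ unitSquare) (hLs : L ⊆ unitSquare) :
    nikodymDist K L = ∫ p in unitSquare, indicatorDiff K L p ^ 2 := by
  have hm : MeasurableSet ((K \ L) ∪ (L \ K)) := (hK.diff hL).union (hL.diff hK)
  have hsub : (K \ L) ∪ (L \ K) ⊆ unitSquare :=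
    Set.union_subset (Set.sdiff_subset.trans hKs) (Set.sdiff_subset.trans hLs)
  simp only [indicatorDiff_sq]
  rw [integral_indicator_one hm, measureReal_restrict_apply hm, Set.inter_eq_left.2 hsub]
  rfl

lemma integral_indicatorDiff_mul_bipolynomial {K L : Set (ℝ × ℝ)} (hK : IsCompact K)
    (hL : IsCompact L) (hKs : K ⊆ unitSquare) (hLs : L ⊆ unitSquare) (m : ℕ) (d : ℕ → ℕ → ℝ) :
    ∫ p in unitSquare, indicatorDiff K L p * bipolynomial m d p =
      ∑ a ∈ Finset.range (m + 1), ∑ b ∈ Finset.range (m + 1),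
        d a b * (geometricMoment K a b - geometricMoment L a b) := by
  have hset : ∀ {A : Set (ℝ × ℝ)}, IsCompact A → A ⊆ unitSquare →
      Integrable (fun p => A.indicator (bipolynomial m d) p) (volume.restrict unitSquare) ∧
      ∫ p in unitSquare, A.indicator (bipolynomial m d) p =
        ∑ a ∈ Finset.range (m + 1), ∑ b ∈ Finset.range (m + 1),
          d a b * geometricMoment A a b := by
    intro A hA hAs
    have hint : ∀ {g : ℝ × ℝ → ℝ}, Continuous g → IntegrableOn g A := fun hg =>
      hg.continuousOn.integrableOn_compact hA
    refine ⟨((integrable_indicator_iff hA.measurableSet).2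
      (hint (continuous_bipolynomial m d))).restrict, ?_⟩
    rw [setIntegral_indicator hA.measurableSet, Set.inter_eq_right.2 hAs]
    simp only [bipolynomial]
    rw [integral_finsetSum _ fun a _ => hint (by fun_prop)]
    refine Finset.sum_congr rfl fun a _ => ?_
    rw [integral_finsetSum _ fun b _ => hint (by fun_prop)]
    refine Finset.sum_congr rfl fun b _ => ?_
    rw [integral_const_mul, geometricMoment]
  have hpt : ∀ p, indicatorDiff K L p * bipolynomial m d p =
      K.indicator (bipolynomial m d) p - L.indicator (bipolynomial m d) p := by
    intro p
    by_cases h1 : p ∈ K <;> by_cases h2 : p ∈ L <;> simp [indicatorDiff, h1, h2]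
  simp only [hpt]
  rw [integral_sub (hset hK hKs).1 (hset hL hLs).1, (hset hK hKs).2, (hset hL hLs).2,
    ← Finset.sum_sub_distrib]
  refine Finset.sum_congr rfl fun a _ => ?_
  rw [← Finset.sum_sub_distrib]
  exact Finset.sum_congr rfl fun b _ => (mul_sub _ _ _).symm

/-- Integrate f² = 2fq + (f - q)² - q² and drop -q². -/
lemma nikodymDist_le_of_bipolynomial {K L : Set (ℝ × ℝ)} (hK : IsCompact K) (hL : IsCompact L)
    (hKs : K ⊆ unitSquare) (hLs : L ⊆ unitSquare) (m : ℕ) (d : ℕ → ℕ → ℝ) :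
    nikodymDist K L ≤
      2 * ∑ a ∈ Finset.range (m + 1), ∑ b ∈ Finset.range (m + 1),
        d a b * (geometricMoment K a b - geometricMoment L a b) +
      ∫ p in unitSquare, (indicatorDiff K L p - bipolynomial m d p) ^ 2 := by
  have hsq : IsCompact unitSquare := isCompact_Icc.prod isCompact_Icc
  have : IsFiniteMeasure (volume.restrict unitSquare) :=
    isFiniteMeasure_restrict.2 hsq.measure_lt_top.ne
  have hfm := measurable_indicatorDiff hK.measurableSet hL.measurableSet
  have hq := continuous_bipolynomial m d
  have hqm := hq.measurable
  have hf1 := abs_indicatorDiff_le_one K L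
  obtain ⟨B, hB⟩ := hsq.exists_bound_of_continuousOn hq.continuousOn
  have hint : ∀ {g : ℝ × ℝ → ℝ} (C : ℝ), Measurable g → (∀ p ∈ unitSquare, |g p| ≤ C) →
      Integrable g (volume.restrict unitSquare) := fun C hg hC =>
    Integrable.of_bound hg.aestronglyMeasurable C
      ((ae_restrict_iff' hsq.measurableSet).2 (Filter.Eventually.of_forall hC))
  have h1 : Integrable (fun p => indicatorDiff K L p ^ 2) (volume.restrict unitSquare) :=
    hint 1 (by fun_prop) fun p _ => by
      rw [abs_pow]
      exact pow_le_one₀ (abs_nonneg _) (hf1 p)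
  have h2 : Integrable (fun p => indicatorDiff K L p * bipolynomial m d p)
      (volume.restrict unitSquare) :=
    hint (1 * B) (by fun_prop) fun p hp => by
      rw [abs_mul]
      exact mul_le_mul (hf1 p) (hB p hp) (abs_nonneg _) zero_le_one
  have h3 : Integrable (fun p => (indicatorDiff K L p - bipolynomial m d p) ^ 2)
      (volume.restrict unitSquare) :=
    hint ((1 + B) ^ 2) (by fun_prop) fun p hp => by
      rw [abs_pow]
      exact pow_le_pow_left₀ (abs_nonneg _)
        ((abs_sub _ _).trans (add_le_add (hf1 p) (hB p hp))) 2
  rw [nikodymDist_eq_integral hK.measurableSet hL.measurableSet hKs hLs,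
    ← integral_indicatorDiff_mul_bipolynomial hK hL hKs hLs, ← integral_const_mul,
    ← integral_add (h2.const_mul 2) h3]
  refine integral_mono h1 ((h2.const_mul 2).add h3) fun p => ?_
  have := sq_nonneg (bipolynomial m d p)
  change indicatorDiff K L p ^ 2 ≤ 2 * (indicatorDiff K L p * bipolynomial m d p) +
    (indicatorDiff K L p - bipolynomial m d p) ^ 2
  linarith

/-! ### Choice of constants and conclusion. -/

/-- Termwise weighted AM-GM. The free weight R produces ε² rather than ε in the final bound. -/
lemma two_mul_sum_mul_le {ι : Type*} (s : Finset ι) (d x : ι → ℝ) {D R : ℝ} (hR : 0 < R)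
    (hd : ∀ i ∈ s, |d i| ≤ D) :
    2 * ∑ i ∈ s, d i * x i ≤ R * ∑ i ∈ s, |x i| ^ 2 + s.card * D ^ 2 / R := by
  rw [Finset.mul_sum, Finset.mul_sum, mul_div_assoc, ← nsmul_eq_mul, ← Finset.sum_const,
    ← Finset.sum_add_distrib]
  refine Finset.sum_le_sum fun i hi => ?_
  have h1 : d i ^ 2 ≤ D ^ 2 := by
    rw [← sq_abs]
    exact pow_le_pow_left₀ (abs_nonneg _) (hd i hi) 2
  have h2 : 2 * (d i * x i) ≤ R * x i ^ 2 + d i ^ 2 / R := by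
    have : R * x i ^ 2 + d i ^ 2 / R - 2 * (d i * x i) = (R * x i - d i) ^ 2 / R := by
      field_simp
      ring
    have := div_nonneg (sq_nonneg (R * x i - d i)) hR.le
    linarith
  rw [sq_abs]
  have : d i ^ 2 / R ≤ D ^ 2 / R := by gcongr
  linarith

/-- As 49 ≤ e⁴ and 2m ≤ n, the exponential part is at most e^(4(n+1)). Five of the six polynomial
factors cost 120·e^(n+1), from the term x⁵/5! of the exponential series; 30720 = 256·120. -/
lemma coefficient_growth_le {m n : ℕ} (hmn : 2 * m ≤ n) :
    ((m : ℝ) + 1) ^ 2 * (16 * ((m : ℝ) + 1) ^ 2 * 49 ^ m) ^ 2 ≤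
      30720 * ((n : ℝ) + 1) * Real.exp (7 * ((n : ℝ) + 1)) := by
  have hx : (0 : ℝ) ≤ (n : ℝ) + 1 := by positivity
  have hm : (m : ℝ) + 1 ≤ (n : ℝ) + 1 := by
    have : m ≤ n := by omega
    gcongr
  have h49 : (49 : ℝ) ≤ Real.exp 4 := by
    have h := Real.exp_one_gt_d9
    have : Real.exp 4 = Real.exp 1 ^ 4 := by
      rw [← Real.exp_nat_mul]
      norm_num
    rw [this]
    calc (49 : ℝ) ≤ 2.7 ^ 4 := by norm_num
      _ ≤ _ := pow_le_pow_left₀ (by norm_num) (by linarith) 4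
  have hpow : ((49 : ℝ) ^ m) ^ 2 ≤ Real.exp (4 * ((n : ℝ) + 1)) := by
    rw [← pow_mul]
    calc (49 : ℝ) ^ (m * 2) ≤ 49 ^ (n + 1) := pow_le_pow_right₀ (by norm_num) (by omega)
      _ ≤ Real.exp 4 ^ (n + 1) := pow_le_pow_left₀ (by norm_num) h49 _
      _ = _ := by
          rw [← Real.exp_nat_mul]
          push_cast
          ring_nf
  have hfac : ((n : ℝ) + 1) ^ 5 ≤ 120 * Real.exp ((n : ℝ) + 1) := by
    have := Real.pow_div_factorial_le_exp _ hx 5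
    rw [div_le_iff₀ (by positivity)] at this
    norm_num [Nat.factorial] at this
    linarith
  calc ((m : ℝ) + 1) ^ 2 * (16 * ((m : ℝ) + 1) ^ 2 * 49 ^ m) ^ 2
      = 256 * ((m : ℝ) + 1) ^ 6 * ((49 : ℝ) ^ m) ^ 2 := by ring
    _ ≤ 256 * ((n : ℝ) + 1) ^ 6 * Real.exp (4 * ((n : ℝ) + 1)) := by gcongr
    _ = 256 * ((n : ℝ) + 1) * ((n : ℝ) + 1) ^ 5 * Real.exp (4 * ((n : ℝ) + 1)) := by ring
    _ ≤ 256 * ((n : ℝ) + 1) * (120 * Real.exp ((n : ℝ) + 1)) *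
          Real.exp (4 * ((n : ℝ) + 1)) := by gcongr
    _ = 30720 * ((n : ℝ) + 1) * Real.exp (5 * ((n : ℝ) + 1)) := by
        have : Real.exp (5 * ((n : ℝ) + 1)) =
            Real.exp ((n : ℝ) + 1) * Real.exp (4 * ((n : ℝ) + 1)) := by
          rw [← Real.exp_add]
          ring_nf
        rw [this]
        ring
    _ ≤ _ := by
        gcongr
        norm_num

theorem mainTheorem4 :
    ∃ a₀ a₁ : ℝ, 0 < a₀ ∧ 0 < a₁ ∧
      ∀ (N : ℕ) (K L : Set (ℝ × ℝ)) (ε : ℝ),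
        IsPlanarConvexBody K → IsPlanarConvexBody L →
        K ⊆ unitSquare → L ⊆ unitSquare → 0 ≤ ε →
        (∑ i ∈ Finset.range (N + 1), ∑ j ∈ Finset.range (N + 1),
          |geometricMoment K i j - geometricMoment L i j| ^ 2) ≤ ε ^ 2 →
        nikodymDist K L ≤
          (Finset.range (N + 1)).inf' Finset.nonempty_range_add_one
            (fun n : ℕ =>
              a₀ * ((n : ℝ) + 1) ^ 2 * Real.exp (7 * ((n : ℝ) + 1)) * ε ^ 2
                + a₁ / ((n : ℝ) + 1)) := by
  refine ⟨30720, 513, by norm_num, by norm_num, fun N K L ε hK hL hKs hLs _ hε =>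
    Finset.le_inf' _ _ fun n hn => ?_⟩
  have hnN : n ≤ N := Nat.lt_succ_iff.1 (Finset.mem_range.1 hn)
  -- Half the available degree is used: at degree n the squared coefficient bound would contain
  -- 49^(2n), which outgrows e^(7n).
  set m := n / 2 with hm
  have hmn : 2 * m ≤ n := by omega
  obtain ⟨d, hd, happrox⟩ := exists_bipolynomial_approximation hK.convex hK.isCompact.isClosed
    hL.convex hL.isCompact.isClosed m
  have hmain := nikodymDist_le_of_bipolynomial hK.isCompact hL.isCompact hKs hLs m d
  -- With this weight Rε² is exactly the first term of the bound, and the coefficient term shrinks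
  -- to 1/(n + 1).
  set R : ℝ := 30720 * ((n : ℝ) + 1) ^ 2 * Real.exp (7 * ((n : ℝ) + 1)) with hR
  have hR0 : 0 < R := by positivity
  have hx : (0 : ℝ) < (n : ℝ) + 1 := by positivity
  have hcs := two_mul_sum_mul_le (Finset.range (m + 1) ×ˢ Finset.range (m + 1))
    (fun i => d i.1 i.2) (fun i => geometricMoment K i.1 i.2 - geometricMoment L i.1 i.2) hR0
    fun i _ => hd i.1 i.2
  rw [Finset.sum_product, Finset.sum_product, Finset.card_product, Finset.card_range] at hcs
  have hsub : Finset.range (m + 1) ⊆ Finset.range (N + 1) :=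
    Finset.range_subset_range.2 (by omega)
  have hmom : ∑ i ∈ Finset.range (m + 1), ∑ j ∈ Finset.range (m + 1),
      |geometricMoment K i j - geometricMoment L i j| ^ 2 ≤ ε ^ 2 := by
    refine le_trans ?_ hε
    refine (Finset.sum_le_sum fun i _ => Finset.sum_le_sum_of_subset_of_nonneg hsub
      fun _ _ _ => by positivity).trans
      (Finset.sum_le_sum_of_subset_of_nonneg hsub fun _ _ _ => by positivity)
  have hcoef : (((m + 1) * (m + 1) : ℕ) : ℝ) * (16 * ((m : ℝ) + 1) ^ 2 * 49 ^ m) ^ 2 / R ≤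
      1 / ((n : ℝ) + 1) := by
    rw [div_le_div_iff₀ hR0 hx, one_mul]
    calc _ = ((m : ℝ) + 1) ^ 2 * (16 * ((m : ℝ) + 1) ^ 2 * 49 ^ m) ^ 2 * ((n : ℝ) + 1) := by
          push_cast
          ring
      _ ≤ 30720 * ((n : ℝ) + 1) * Real.exp (7 * ((n : ℝ) + 1)) * ((n : ℝ) + 1) :=
          mul_le_mul_of_nonneg_right (coefficient_growth_le hmn) hx.le
      _ = R := by
          rw [hR]
          ring
  -- Rounding down in n / 2 still leaves n + 1 ≤ 2(m + 1). With the coefficient term this gives 513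
  -- = 512 + 1.
  have herr : 256 / ((m : ℝ) + 1) ≤ 512 / ((n : ℝ) + 1) := by
    rw [div_le_div_iff₀ (by positivity) hx]
    have : (n : ℝ) ≤ 2 * m + 1 := by
      have : n ≤ 2 * m + 1 := by omega
      exact_mod_cast this
    linarith
  have hRε := mul_le_mul_of_nonneg_left hmom hR0.le
  have hsplit : 513 / ((n : ℝ) + 1) = 1 / ((n : ℝ) + 1) + 512 / ((n : ℝ) + 1) := by ring
  rw [hsplit]
  linarith
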